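/- Let $E$ be a set and let $S=\mathbb{R}_+^E$ be the space of all functions $E\to\mathbb{R}_+=[0,\infty)$ with its cylindrical $\sigma$-algebra. Let $\mathcal{M}(S)$ be the space of finite measures on $S$, with the $\sigma$-algebra generated by the maps $\mu\mapsto\mu(A)$, $A\subset S$ measurable. Let $N$ be a Poisson random measure on $S$ with intensity $\nu$, where $\nu$ is a measure on $S$ (not necessarily finite): $N$ is a random measure such that $N(A)$ is Poisson distributed with mean $\nu(A)$ for every measurable $A$ (with $N(A)=\infty$ a.s. if $\nu(A)=\infty$), and $N(A_1),\dots,N(A_n)$ are independent whenever $A_1,\dots,A_n$ are measurable and pairwise disjoint. Let $\lambda$ be the Lévy measure of $N$ as an infinitely divisible random measure, that is, $\lambda$ is a measure on $\mathcal{M}(S)$ with $\lambda(\{0\})=0$ for which there is a non-random $m\in\mathcal{M}(S)$ (the drift) such that, for all $n\ge 0$, all measurable $A_1,\dots,A_n\subset S$ and all $\alpha_1,\dots,\alpha_n\ge 0$, \[ \mathbb{E}\Big[e^{-\sum_{i=1}^n\alpha_i N(A_i)}\Big]=\exp\Big\{-\sum_{i=1}^n\alpha_i m(A_i)-\int_{\mathcal{M}(S)}\Big(1-e^{-\sum_{i=1}^n\alpha_i\mu(A_i)}\Big)\,\lambda(d\mu)\Big\}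 \] (with $e^{-\infty}=0$ and $0\cdot\infty=0$). Then \[ \nu=\int_{\mathcal{M}(S)}\mu\,\lambda(d\mu), \] that is, $\nu(A)=\int_{\mathcal{M}(S)}\mu(A)\,\lambda(d\mu)$ for every measurable $A\subset S$. -/

import Mathlib

open MeasureTheory ProbabilityTheory
open scoped ENNReal NNReal

/-- The space `M(S)` of finite measures on a measurable space `S`. As a subtype of `Measure S` it
carries the σ-algebra generated by the evaluations `μ ↦ μ A`, `A` measurable. -/
abbrev FinMeas (S : Type*) [MeasurableSpace S] : Type _ :=
  {μ : Measure S // IsFiniteMeasure μ}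

/-- `t ↦ exp (-t)` on `[0, ∞]`, with `exp (-∞) = 0`. -/
noncomputable def expNeg (t : ℝ≥0∞) : ℝ≥0∞ := EReal.exp (-(t : EReal))

/-- The Poisson distribution with mean `t ∈ [0, ∞]`, as a law on `[0, ∞]`
(the point mass at `∞` when `t = ∞`). -/
noncomputable def poissonLaw (t : ℝ≥0∞) : Measure ℝ≥0∞ :=
  if t = ∞ then Measure.dirac ∞
  else (poissonMeasure t.toNNReal).map (fun n : ℕ => (n : ℝ≥0∞))

/-- `N` is a Poisson random measure on `S` with intensity `ν`: a measurable map into the measures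
on `S` such that `N A` has the Poisson distribution with mean `ν A` for every measurable `A`, and
`N (A 1), …, N (A n)` are independent for pairwise disjoint measurable `A 1, …, A n`. -/
structure IsPoissonRandomMeasure {Ω S : Type*} [MeasurableSpace Ω] [MeasurableSpace S]
    (P : Measure Ω) (N : Ω → Measure S) (ν : Measure S) : Prop where
  measurable : Measurable N
  law : ∀ A : Set S, MeasurableSet A → P.map (fun ω => N ω A) = poissonLaw (ν A)
  indep : ∀ (n : ℕ) (A : Fin n → Set S), (∀ i, MeasurableSet (A i)) →
    Pairwise (fun i j => Disjoint (A i) (A j)) → iIndepFun (fun i ω => N ω (A i)) P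

/-- `lam` is the Lévy measure of the (infinitely divisible) random measure `ξ` on `S`: a measure on
`M(S)` without mass at the zero measure such that, for some non-random drift `m ∈ M(S)`, all the
vectors `(ξ (A 1), …, ξ (A n))` have the Laplace transform
`E[exp (-∑ αᵢ ξ(Aᵢ))] = exp (-∑ αᵢ m(Aᵢ) - ∫ (1 - exp (-∑ αᵢ μ(Aᵢ))) lam(dμ))`. -/
structure IsLevyMeasure {Ω S : Type*} [MeasurableSpace Ω] [MeasurableSpace S]
    (P : Measure Ω) (ξ : Ω → Measure S) (lam : Measure (FinMeas S)) : Prop where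
  zero : lam {μ | μ.1 = 0} = 0
  laplace : ∃ m : FinMeas S, ∀ (n : ℕ) (A : Fin n → Set S) (α : Fin n → ℝ≥0),
    (∀ i, MeasurableSet (A i)) →
      ∫⁻ ω, expNeg (∑ i, α i * ξ ω (A i)) ∂P
        = expNeg (∑ i, α i * m.1 (A i)
            + ∫⁻ μ : FinMeas S, (1 - expNeg (∑ i, α i * μ.1 (A i))) ∂lam)

open Filter
open scoped Topology

/-! Comparing the two Laplace exponents of `N A` gives, for `a > 0`, `ν(A) (1 - e^{-a}) = a m(A) + ∫
(1 - e^{-a μ(A)}) λ(dμ)` (`exists_drift`). If `ν(A) < ∞`, the left side is bounded in `a`, so `m(A)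
= 0`; dividing by `a` and letting `a → 0` turns the identity into `ν(A) = ∫ μ(A) λ(dμ)`. If `ν(A) =
∞`, then `1 - e^{-x} ≤ x` already makes the right-hand integral infinite. -/

lemma expNeg_coe (x : ℝ≥0) : expNeg x = ENNReal.ofReal (Real.exp (-x)) := rfl

/-- Lets exponents be read off from Laplace transforms even when they are infinite. -/
lemma expNeg_injective : Function.Injective expNeg := fun _ _ h =>
  EReal.coe_ennreal_injective (neg_injective (EReal.exp_strictMono.injective h))

lemma measurable_expNeg : Measurable expNeg :=
  EReal.measurable_exp.comp measurable_coe_ennreal_ereal.neg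

lemma one_sub_expNeg_coe (x : ℝ≥0) :
    1 - expNeg x = ENNReal.ofReal (1 - Real.exp (-x)) := by
  rw [expNeg_coe, ENNReal.ofReal_sub _ (Real.exp_pos _).le, ENNReal.ofReal_one]

lemma one_sub_expNeg_le (x : ℝ≥0∞) : 1 - expNeg x ≤ x := by
  induction x with
  | top => exact le_top
  | coe x =>
    rw [one_sub_expNeg_coe, ← ENNReal.ofReal_coe_nnreal]
    exact ENNReal.ofReal_le_ofReal (by linarith [Real.one_sub_le_exp_neg (x : ℝ)])

lemma one_sub_expNeg_coe_ne_zero {a : ℝ≥0} (ha : a ≠ 0) : 1 - expNeg a ≠ 0 := by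
  have ha' : 0 < (a : ℝ) := NNReal.coe_pos.2 (pos_iff_ne_zero.2 ha)
  rw [one_sub_expNeg_coe, ← pos_iff_ne_zero, ENNReal.ofReal_pos]
  simpa using ha'

/-- `(1 - exp (-x / n)) n → x`. -/
lemma tendsto_natCast_mul_one_sub_expNeg (x : ℝ≥0) :
    Tendsto (fun n : ℕ => (n : ℝ≥0∞) * (1 - expNeg (((n : ℝ≥0)⁻¹ : ℝ≥0) * x))) atTop (𝓝 x) := by
  have hd : HasDerivAt (fun t : ℝ => 1 - Real.exp (-(t * x))) x 0 := by
    simpa using (((hasDerivAt_id (0 : ℝ)).mul_const (x : ℝ)).neg.exp).const_sub 1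
  have ht := ENNReal.tendsto_ofReal <| hd.tendsto_slope_zero_right.comp
    (tendsto_inv_atTop_nhdsGT_zero.comp (tendsto_natCast_atTop_atTop (R := ℝ)))
  rw [ENNReal.ofReal_coe_nnreal] at ht
  refine ht.congr fun n => ?_
  rw [← ENNReal.coe_mul, one_sub_expNeg_coe]
  simp [ENNReal.ofReal_mul]

/-- The Laplace transform of the Poisson distribution. -/
lemma lintegral_expNeg_mul_poissonLaw {a : ℝ≥0} (ha : a ≠ 0) (t : ℝ≥0∞) :
    ∫⁻ x, expNeg (a * x) ∂poissonLaw t = expNeg (t * (1 - expNeg a)) := by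
  have hm : Measurable fun x : ℝ≥0∞ => expNeg (a * x) :=
    measurable_expNeg.comp (measurable_id.const_mul _)
  induction t with
  | top =>
    rw [poissonLaw, if_pos rfl, lintegral_dirac' _ hm,
      ENNReal.mul_top (ENNReal.coe_ne_zero.2 ha), ENNReal.top_mul (one_sub_expNeg_coe_ne_zero ha)]
  | coe t =>
    rw [poissonLaw, if_neg ENNReal.coe_ne_top, ENNReal.toNNReal_coe,
      lintegral_map hm .of_discrete, poissonMeasure, lintegral_sum_measure]
    -- The Poisson weights absorb `e^{-an}` into the power `(t e^{-a})^n`, leaving an exponential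
    -- series.
    have hs : HasSum (fun n : ℕ => Real.exp (-t) * ((t * Real.exp (-a)) ^ n / n.factorial))
        (Real.exp (-t) * Real.exp (t * Real.exp (-a))) := by
      have h := NormedSpace.expSeries_div_hasSum_exp ((t : ℝ) * Real.exp (-a))
      rw [← Real.exp_eq_exp_ℝ] at h
      exact h.mul_left _
    have hr : (t : ℝ≥0∞) * (1 - expNeg a) = (t * (1 - Real.exp (-a)).toNNReal : ℝ≥0) := by
      rw [one_sub_expNeg_coe, ENNReal.coe_mul]; rfl
    have h0 : 0 ≤ 1 - Real.exp (-(a : ℝ)) := by simp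
    rw [hr, expNeg_coe, NNReal.coe_mul, Real.coe_toNNReal _ h0,
      show -((t : ℝ) * (1 - Real.exp (-a))) = -t + t * Real.exp (-a) by ring, Real.exp_add,
      ← hs.tsum_eq, ENNReal.ofReal_tsum_of_nonneg (fun n => by positivity) hs.summable]
    refine tsum_congr fun n => ?_
    rw [lintegral_smul_measure, lintegral_dirac, smul_eq_mul,
      show (a : ℝ≥0∞) * (n : ℝ≥0∞) = (a * n : ℝ≥0) by push_cast; rfl, expNeg_coe,
      ← ENNReal.ofReal_mul (by positivity)]
    congr 1
    rw [mul_pow, ← Real.exp_nat_mul]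
    push_cast
    rw [show (n : ℝ) * -(a : ℝ) = -(a * n) by ring]
    ring

section LevyMeasure

variable {Ω S : Type*} [MeasurableSpace Ω] [MeasurableSpace S] {P : Measure Ω}
  {N : Ω → Measure S} {ν : Measure S} {lam : Measure (FinMeas S)}

/-- The identity between the Laplace exponents of `N A`. -/
lemma IsPoissonRandomMeasure.exists_drift (hN : IsPoissonRandomMeasure P N ν)
    (hlam : IsLevyMeasure P N lam) :
    ∃ m : FinMeas S, ∀ A, MeasurableSet A → ∀ a : ℝ≥0, a ≠ 0 →
      ν A * (1 - expNeg a) = a * m.1 A + ∫⁻ μ : FinMeas S, (1 - expNeg (a * μ.1 A)) ∂lam := by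
  obtain ⟨m, hm⟩ := hlam.laplace
  refine ⟨m, fun A hA a ha => expNeg_injective ?_⟩
  have h := hm 1 (fun _ => A) (fun _ => a) fun _ => hA
  simp only [Finset.univ_unique, Finset.sum_const, Finset.card_singleton, one_smul] at h
  rw [← h, ← lintegral_expNeg_mul_poissonLaw ha, ← hN.law A hA]
  exact lintegral_map (measurable_expNeg.comp (measurable_id.const_mul _))
    ((Measure.measurable_coe hA).comp hN.measurable)

lemma measurable_finMeas_apply {A : Set S} (hA : MeasurableSet A) :
    Measurable fun μ : FinMeas S => μ.1 A :=
  (Measure.measurable_coe hA).comp measurable_subtype_coe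

/-- The intensity of a Poisson random measure is the barycenter of its Lévy measure. -/
theorem IsPoissonRandomMeasure.lintegral_levyMeasure (hN : IsPoissonRandomMeasure P N ν)
    (hlam : IsLevyMeasure P N lam) {A : Set S} (hA : MeasurableSet A) :
    ∫⁻ μ : FinMeas S, μ.1 A ∂lam = ν A := by
  obtain ⟨m, hm⟩ := hN.exists_drift hlam
  have hm := hm A hA
  have hup (a : ℝ≥0) : ∫⁻ μ : FinMeas S, (1 - expNeg (a * μ.1 A)) ∂lam
      ≤ a * ∫⁻ μ : FinMeas S, μ.1 A ∂lam := by
    rw [← lintegral_const_mul _ (measurable_finMeas_apply hA)]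
    exact lintegral_mono fun μ => one_sub_expNeg_le _
  by_cases hν : ν A = ∞
  -- The drift term is finite, so at `a = 1` the Lévy integral must carry the infinite mass.
  · have := m.2
    have h := hm 1 one_ne_zero
    rw [hν, ENNReal.top_mul (one_sub_expNeg_coe_ne_zero one_ne_zero)] at h
    have h2 := (ENNReal.add_eq_top.1 h.symm).resolve_left
      (ENNReal.mul_ne_top ENNReal.coe_ne_top (measure_ne_top _ _))
    have h3 := hup 1
    rw [h2, ENNReal.coe_one, one_mul, top_le_iff] at h3
    rw [h3, hν]
  -- A positive `m(A)` would make `n * m(A)` exceed the bound `ν(A)` for large `n`.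
  have hm0 : m.1 A = 0 := by
    by_contra h0
    obtain ⟨n, hn⟩ := ENNReal.exists_nat_mul_gt h0 hν
    have hn0 : (n : ℝ≥0) ≠ 0 := by
      rintro h
      have : n = 0 := by exact_mod_cast h
      simp [this] at hn
    refine hn.not_ge ?_
    calc (n : ℝ≥0∞) * m.1 A = ((n : ℝ≥0) : ℝ≥0∞) * m.1 A := by push_cast; rfl
      _ ≤ ν A * (1 - expNeg (n : ℝ≥0)) := by rw [hm _ hn0]; exact le_self_add
      _ ≤ ν A * 1 := by gcongr; exact tsub_le_self
      _ = ν A := mul_one _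
  have hinv : ∀ n : ℕ, n ≠ 0 → (n : ℝ≥0∞) * ((n : ℝ≥0)⁻¹ : ℝ≥0) = 1 := fun n hn => by
    rw [← ENNReal.coe_natCast, ← ENNReal.coe_mul, mul_inv_cancel₀ (by exact_mod_cast hn),
      ENNReal.coe_one]
  -- The identity at `a = 1/n`, multiplied by `n`.
  have hlim : Tendsto (fun n : ℕ => (n : ℝ≥0∞) *
      ∫⁻ μ : FinMeas S, (1 - expNeg (((n : ℝ≥0)⁻¹ : ℝ≥0) * μ.1 A)) ∂lam) atTop (𝓝 (ν A)) := by
    have h := ENNReal.Tendsto.const_mul (a := ν A) (tendsto_natCast_mul_one_sub_expNeg 1)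
      (Or.inr hν)
    rw [ENNReal.coe_one, mul_one] at h
    refine h.congr' ?_
    filter_upwards [eventually_ne_atTop 0] with n hn
    have h := hm (n : ℝ≥0)⁻¹ (inv_ne_zero (by exact_mod_cast hn))
    rw [hm0, mul_zero, zero_add] at h
    rw [← h, mul_one, mul_left_comm]
  apply le_antisymm
  -- Fatou's lemma: the integrands tend to `μ(A)` pointwise because each `μ` is finite.
  · have hmeas (n : ℕ) : Measurable fun μ : FinMeas S =>
        1 - expNeg (((n : ℝ≥0)⁻¹ : ℝ≥0) * μ.1 A) :=
      measurable_const.sub (measurable_expNeg.comp ((measurable_finMeas_apply hA).const_mul _))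
    calc ∫⁻ μ : FinMeas S, μ.1 A ∂lam
        = ∫⁻ μ : FinMeas S, liminf (fun n : ℕ => (n : ℝ≥0∞) *
            (1 - expNeg (((n : ℝ≥0)⁻¹ : ℝ≥0) * μ.1 A))) atTop ∂lam := by
          refine lintegral_congr fun μ => ?_
          have := μ.2
          have h := tendsto_natCast_mul_one_sub_expNeg (μ.1 A).toNNReal
          rw [ENNReal.coe_toNNReal (measure_ne_top _ _)] at h
          exact h.liminf_eq.symm
      _ ≤ liminf (fun n : ℕ => ∫⁻ μ : FinMeas S, (n : ℝ≥0∞) *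
            (1 - expNeg (((n : ℝ≥0)⁻¹ : ℝ≥0) * μ.1 A)) ∂lam) atTop :=
          lintegral_liminf_le fun n => (hmeas n).const_mul _
      _ = ν A := by
          simp_rw [fun n : ℕ => lintegral_const_mul (μ := lam) (n : ℝ≥0∞) (hmeas n)]
          exact hlim.liminf_eq
  -- Each term of the limit is at most `∫ μ(A) λ(dμ)`, by `1 - e^{-x} ≤ x`.
  · refine le_of_tendsto hlim ?_
    filter_upwards [eventually_ne_atTop 0] with n hn
    calc _ ≤ (n : ℝ≥0∞) * (((n : ℝ≥0)⁻¹ : ℝ≥0) * ∫⁻ μ : FinMeas S, μ.1 A ∂lam) := by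
          gcongr; exact hup _
      _ = _ := by rw [← mul_assoc, hinv n hn, one_mul]

end LevyMeasure

theorem mainTheorem9 {E Ω : Type*} [MeasurableSpace Ω] (P : Measure Ω) [IsProbabilityMeasure P]
    (N : Ω → Measure (E → ℝ≥0)) (ν : Measure (E → ℝ≥0)) (lam : Measure (FinMeas (E → ℝ≥0)))
    (hN : IsPoissonRandomMeasure P N ν) (hlam : IsLevyMeasure P N lam) :
    ν = lam.bind (fun μ => μ.1) := by
  ext A hA
  rw [Measure.bind_apply hA measurable_subtype_coe.aemeasurable]
  exact (hN.lintegral_levyMeasure hlam hA).symm
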